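/- Let $a,b<0$ and $\lambda,\mu>0$. Given $u^0=(u^0_{j,k})_{j,k\ge 0}\in\ell^2(\mathbb N^2;\mathbb R)$, define $u^n_{j,k}$ for $n,j,k\in\mathbb N$ inductively by the Lax–Wendroff scheme with a stabilizer for the transport equation $\partial_t u+a\,\partial_x u+b\,\partial_y u=0$ in the quarter-plane: for all $n,j,k\ge 0$, $$\begin{aligned} u_{j,k}^{n+1} = u_{j,k}^n &- \tfrac{\lambda a}{2}\big(u_{j+1,k}^n-u_{j-1,k}^n\big) - \tfrac{\mu b}{2}\big(u_{j,k+1}^n-u_{j,k-1}^n\big)\\ &+ \tfrac{(\lambda a)^2}{2}\big(u_{j+1,k}^n-2u_{j,k}^n+u_{j-1,k}^n\big) + \tfrac{(\mu b)^2}{2}\big(u_{j,k+1}^n-2u_{j,k}^n+u_{j,k-1}^n\big)\\ &+ \tfrac{\lambda a\,\mu b}{4}\big(u_{j+1,k+1}^n-u_{j+1,k-1}^n-u_{j-1,k+1}^n+u_{j-1,k-1}^n\big)\\ &- \tfrac{(\lambda a)^2+(\mu b)^2}{8}\big(u_{j+1,k+1}^n-2u_{j+1,k}^n+u_{j+1,k-1}^n-2u_{j,k+1}^n+4u_{j,k}^n-2u_{j,k-1}^n\\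 &\qquad\qquad\qquad\quad +u_{j-1,k+1}^n-2u_{j-1,k}^n+u_{j-1,k-1}^n\big), \end{aligned}$$ where the ghost values are given by second-order extrapolation, $u^n_{-1,k}=2u^n_{0,k}-u^n_{1,k}$ for $k\ge 0$ and $u^n_{j,-1}=2u^n_{j,0}-u^n_{j,1}$ for $j\ge 0$, together with the corner condition $u^n_{-1,-1}=4u^n_{0,0}-2u^n_{1,0}-2u^n_{0,1}+u^n_{1,1}$. Let $$\|u\|^2:=\sum_{j,k\ge 1}u_{j,k}^2+\tfrac12\sum_{k\ge 1}u_{0,k}^2+\tfrac12\sum_{j\ge 1}u_{j,0}^2+\tfrac14 u_{0,0}^2 .$$ **Theorem.** For every $M>0$ there exists $\varepsilon>0$, depending only on $M$, such that the following holds with $c=1/10$. For all $a,b<0$ and $\lambda,\mu>0$ with $$\lambda|a|\le M\,\mu|b|,\qquad \mu|b|\le M\,\lambda|a|,\qquad (\lambda a)^2+(\mu b)^2\le\varepsilon,$$ and for every $u^0\in\ell^2(\mathbb N^2;\mathbb R)$, one has, for every $n\in\mathbb N$, $u^n\in\ell^2(\mathbb N^2;\mathbb R)$ and $$\begin{aligned}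 \|u^{n+1}\|^2-\|u^n\|^2 &+ c\,(\lambda a)^2\sum_{j,k\ge 1}\big(u^n_{j-1,k}-2u^n_{j,k}+u^n_{j+1,k}\big)^2 + c\,(\mu b)^2\sum_{j,k\ge 1}\big(u^n_{j,k-1}-2u^n_{j,k}+u^n_{j,k+1}\big)^2\\ &+ c\,\lambda|a|\sum_{k\ge 0}(u^n_{0,k})^2 + c\,\mu|b|\sum_{j\ge 0}(u^n_{j,0})^2\;\le\;0 . \end{aligned}$$ -/

import Mathlib

noncomputable section

/-- The extension of interior values `v j k`, `j, k ≥ 0`, to the ghost cells: second order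
extrapolation on both edges and the extrapolated corner value.
Only the indices `≥ -1` are ever used, so that a negative index always stands for `-1`. -/
def ghost (v : ℕ → ℕ → ℝ) : ℤ → ℤ → ℝ
  | Int.ofNat j, Int.ofNat k => v j k
  | Int.negSucc _, Int.ofNat k => 2 * v 0 k - v 1 k
  | Int.ofNat j, Int.negSucc _ => 2 * v j 0 - v j 1
  | Int.negSucc _, Int.negSucc _ => 4 * v 0 0 - 2 * v 1 0 - 2 * v 0 1 + v 1 1

/-- The value in the cell `(j, k)` produced by the Lax–Wendroff scheme with a stabilizer from
values `U` on the cells with indices `≥ -1`; `α` and `β` stand for `λ a` and `μ b`. -/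
def laxWendroff (α β : ℝ) (U : ℤ → ℤ → ℝ) (j k : ℤ) : ℝ :=
  U j k
    - α / 2 * (U (j + 1) k - U (j - 1) k)
    - β / 2 * (U j (k + 1) - U j (k - 1))
    + α ^ 2 / 2 * (U (j + 1) k - 2 * U j k + U (j - 1) k)
    + β ^ 2 / 2 * (U j (k + 1) - 2 * U j k + U j (k - 1))
    + α * β / 4 * (U (j + 1) (k + 1) - U (j + 1) (k - 1)
        - U (j - 1) (k + 1) + U (j - 1) (k - 1))
    - (α ^ 2 + β ^ 2) / 8 * (U (j + 1) (k + 1) - 2 * U (j + 1) k + U (j + 1) (k - 1)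
        - 2 * U j (k + 1) + 4 * U j k - 2 * U j (k - 1)
        + U (j - 1) (k + 1) - 2 * U (j - 1) k + U (j - 1) (k - 1))

/-- The numerical solution `u^n_{j,k}`, `n, j, k ≥ 0`, with initial values `u0`, velocities `a, b`
and ratios `lam, mu`. -/
def numSol (a b lam mu : ℝ) (u0 : ℕ → ℕ → ℝ) : ℕ → ℕ → ℕ → ℝ
  | 0 => u0
  | n + 1 => fun j k =>
      laxWendroff (lam * a) (mu * b) (ghost (numSol a b lam mu u0 n)) (j : ℤ) (k : ℤ)

/-- The modified energy `‖u‖²`, with weight `1/2` on the two boundary rows and `1/4` at the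
corner. -/
def energy (u : ℕ → ℕ → ℝ) : ℝ :=
  (∑' p : ℕ × ℕ, u (p.1 + 1) (p.2 + 1) ^ 2)
    + 1 / 2 * (∑' k : ℕ, u 0 (k + 1) ^ 2)
    + 1 / 2 * (∑' j : ℕ, u (j + 1) 0 ^ 2)
    + 1 / 4 * u 0 0 ^ 2

end

/-!
The ghost values are tensor products of one-dimensional second order extrapolations. Hence the
scheme is a polynomial in the operators `diffCen` (centred difference, forward difference on the
boundary) and `diffTwo` (second difference, zero on the boundary), acting in each index, on the
space of square-summable arrays, see `stepOp_apply`. The modified energy is the sum with the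
tensor product weight `(1/2, 1, 1, …) ⊗ (1/2, 1, 1, …)`, for which these operators satisfy exact
summation by parts formulas: `form_half_diffCen`, `form_half_diffTwo`,
`form_half_diffCen_diffCen` and `form_half_diffCen_diffTwo`. They hold with any weight in the other
index, so that they can be iterated and used on the boundary as well.

Expanding the energy of `u + v`, where `v` is the increment, and sorting by powers of
`A = λ|a|` and `B = μ|b|`, one gets the following.

* Order one is `-A ∑ u_{0,k}² - B ∑ u_{j,0}²`, with weights `1/2` at the corner.
* At order two, the squared norms of the centred differences cancel against the second order terms
  of the scheme up to `-A²/4` and `-B²/4` times the squared norms of the second differences, the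
  mixed terms reduce to a corner term, and the stabilizer gives `-(A² + B²)/4` times the squared
  norm of the mixed first difference up to boundary terms (`le_form_stabilizer`).
* At order three, each direction alone gives a boundary term with a good sign, which together with
  order one absorbs the boundary term `-A² ∑ u_{0,k} (u_{1,k} - u_{0,k})` of order two; the mixed
  terms are controlled by boundary terms and by the mixed difference (`cubic_cross_le`,
  `le_form_diffCen_stabilizer`).
* Order four is controlled by the dissipation of order two (`form_higherOrder_self_le`).

What is left of order two is a multiple of `A² + B²` times boundary sums. Since `A` and `B` are
comparable and small, it is dominated by the order one dissipation (`form_stepOp_le`).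
-/

/-! ### Square-summable arrays, weighted forms and shifts -/

/-- The square-summable real arrays indexed by `ℕ × ℕ`. -/
def squareSummable : Submodule ℝ (ℕ × ℕ → ℝ) where
  carrier := {f | Summable fun p => f p ^ 2}
  zero_mem' := by simp
  add_mem' {f g} hf hg := by
    refine Summable.of_nonneg_of_le (fun p => sq_nonneg _) (fun p => ?_)
      ((hf.mul_left 2).add (hg.mul_left 2))
    have := sq_nonneg (f p - g p)
    simp only [Pi.add_apply]
    nlinarith
  smul_mem' c f hf := by
    have := Summable.mul_left (c ^ 2) hf
    simpa [mul_pow] using this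

theorem summable_weighted_mul (w : ℕ × ℕ → unitInterval) (f g : squareSummable) :
    Summable fun p => (w p : ℝ) * (f.1 p * g.1 p) := by
  refine Summable.of_norm_bounded (f.2.add g.2) (fun p => ?_)
  have h0 := (w p).2.1
  have h1 := (w p).2.2
  rw [Real.norm_eq_abs, abs_mul, abs_of_nonneg h0]
  have h2 : |f.1 p * g.1 p| ≤ f.1 p ^ 2 + g.1 p ^ 2 := by
    rw [abs_le]
    constructor <;> nlinarith [sq_nonneg (f.1 p - g.1 p), sq_nonneg (f.1 p + g.1 p),
      sq_nonneg (f.1 p), sq_nonneg (g.1 p)]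
  calc (w p : ℝ) * |f.1 p * g.1 p| ≤ 1 * |f.1 p * g.1 p| :=
        mul_le_mul_of_nonneg_right h1 (abs_nonneg _)
    _ ≤ _ := by rwa [one_mul]

/-- The bilinear form `∑ p_j q_k f_{j,k} g_{j,k}` with the tensor product weight `p ⊗ q`. -/
noncomputable def form (p q : ℕ → unitInterval) : LinearMap.BilinForm ℝ squareSummable :=
  LinearMap.mk₂ ℝ (fun f g => ∑' i : ℕ × ℕ, ((p i.1 * q i.2 : unitInterval) : ℝ) * (f.1 i * g.1 i))
    (fun f f' g => by
      rw [← (summable_weighted_mul _ f g).tsum_add (summable_weighted_mul _ f' g)]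
      exact tsum_congr fun i => by simp only [Submodule.coe_add, Pi.add_apply]; ring)
    (fun c f g => by
      rw [smul_eq_mul, ← tsum_mul_left]
      exact tsum_congr fun i => by simp only [Submodule.coe_smul, Pi.smul_apply, smul_eq_mul]; ring)
    (fun f g g' => by
      rw [← (summable_weighted_mul _ f g).tsum_add (summable_weighted_mul _ f g')]
      exact tsum_congr fun i => by simp only [Submodule.coe_add, Pi.add_apply]; ring)
    (fun c f g => by
      rw [smul_eq_mul, ← tsum_mul_left]
      exact tsum_congr fun i => by simp only [Submodule.coe_smul, Pi.smul_apply, smul_eq_mul]; ring)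

theorem form_apply (p q : ℕ → unitInterval) (f g : squareSummable) :
    form p q f g = ∑' i : ℕ × ℕ, ((p i.1 * q i.2 : unitInterval) : ℝ) * (f.1 i * g.1 i) := rfl

theorem form_comm (p q : ℕ → unitInterval) (f g : squareSummable) :
    form p q f g = form p q g f :=
  tsum_congr fun i => by rw [mul_comm (f.1 i)]

theorem form_self_nonneg (p q : ℕ → unitInterval) (f : squareSummable) : 0 ≤ form p q f f :=
  tsum_nonneg fun i => mul_nonneg (p i.1 * q i.2).2.1 (mul_self_nonneg _)

/-- The shift `f ↦ f_{j+1,k}` in the first index. -/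
def shift : Module.End ℝ squareSummable where
  toFun f := ⟨fun p => f.1 (p.1 + 1, p.2), f.2.comp_injective
    (i := fun p : ℕ × ℕ => (p.1 + 1, p.2)) fun p q h => by aesop⟩
  map_add' _ _ := rfl
  map_smul' _ _ := rfl

/-- The shift `f ↦ f_{j-1,k}` in the first index, with the value `0` on the boundary `j = 0`. -/
def unshift : Module.End ℝ squareSummable where
  toFun f := ⟨fun p => Nat.casesOn p.1 0 fun j => f.1 (j, p.2), by
    refine (Function.Injective.summable_iff (g := fun p : ℕ × ℕ => (p.1 + 1, p.2))
      (fun p q h => by aesop) ?_).1 f.2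
    rintro ⟨_ | j, k⟩ h
    · simp
    · exact absurd ⟨(j, k), rfl⟩ h⟩
  map_add' f g := by ext ⟨_ | j, k⟩ <;> simp
  map_smul' c f := by ext ⟨_ | j, k⟩ <;> simp

/-- The exchange of the two indices. -/
def transpose : Module.End ℝ squareSummable where
  toFun f := ⟨fun p => f.1 p.swap, f.2.comp_injective Prod.swap_injective⟩
  map_add' _ _ := rfl
  map_smul' _ _ := rfl

/-- Conjugation by `transpose`: it turns an operator in the first index into the same operator in
the second index. -/
def flipEnd (L : Module.End ℝ squareSummable) : Module.End ℝ squareSummable :=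
  transpose * L * transpose

theorem form_transpose (p q : ℕ → unitInterval) (f g : squareSummable) :
    form p q (transpose f) (transpose g) = form q p f g := by
  rw [form_apply, form_apply, ← (Equiv.prodComm ℕ ℕ).tsum_eq]
  exact tsum_congr fun i => by simp [transpose, mul_comm (p i.2)]

theorem flipEnd_transpose (L : Module.End ℝ squareSummable) (f : squareSummable) :
    flipEnd L (transpose f) = transpose (L f) := rfl

theorem transpose_flipEnd (L : Module.End ℝ squareSummable) (f : squareSummable) :
    transpose (flipEnd L f) = L (transpose f) := rfl

/-- The forward difference `f_{j+1,k} - f_{j,k}`. -/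
def diff : Module.End ℝ squareSummable := shift - 1

/-- The second difference `f_{j+1,k} - 2 f_{j,k} + f_{j-1,k}` for `j ≥ 1`; on the boundary `j = 0`
it is `0`, as second order extrapolation of `f` makes it. -/
def diffTwo : Module.End ℝ squareSummable := unshift * (diff * diff)

/-- The centred difference `(f_{j+1,k} - f_{j-1,k}) / 2` for `j ≥ 1`; on the boundary `j = 0` it is
`f_{1,k} - f_{0,k}`, as second order extrapolation of `f` makes it. -/
noncomputable def diffCen : Module.End ℝ squareSummable := diff - (1 / 2 : ℝ) • diffTwo

theorem commute_shift_flipEnd_shift : Commute shift (flipEnd shift) := rfl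

theorem commute_unshift_flipEnd_shift : Commute unshift (flipEnd shift) := by
  ext f ⟨_ | j, k⟩ <;> rfl

theorem commute_shift_flipEnd_unshift : Commute shift (flipEnd unshift) := by
  ext f ⟨j, _ | k⟩ <;> rfl

theorem commute_unshift_flipEnd_unshift : Commute unshift (flipEnd unshift) := by
  ext f ⟨_ | j, _ | k⟩ <;> rfl

theorem flipEnd_diff : flipEnd diff = flipEnd shift - 1 := rfl

theorem flipEnd_diffCen : flipEnd diffCen = flipEnd diff - (1 / 2 : ℝ) • flipEnd diffTwo := rfl

section Commutation

variable {L : Module.End ℝ squareSummable}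

theorem commute_diff (h : Commute shift L) : Commute diff L := by
  unfold diff
  exact Commute.sub_left (R := Module.End ℝ squareSummable) h (Commute.one_left L)

theorem commute_diffTwo (h : Commute shift L) (h' : Commute unshift L) : Commute diffTwo L :=
  h'.mul_left ((commute_diff h).mul_left (commute_diff h))

theorem commute_diffCen (h : Commute shift L) (h' : Commute unshift L) : Commute diffCen L := by
  unfold diffCen
  exact Commute.sub_left (R := Module.End ℝ squareSummable) (commute_diff h)
    ((commute_diffTwo h h').smul_left _)

theorem commute_flipEnd_diff (h : Commute L (flipEnd shift)) : Commute L (flipEnd diff) := by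
  rw [flipEnd_diff]
  exact Commute.sub_right (R := Module.End ℝ squareSummable) h (Commute.one_right L)

theorem commute_flipEnd_diffTwo (h : Commute L (flipEnd shift))
    (h' : Commute L (flipEnd unshift)) : Commute L (flipEnd diffTwo) :=
  h'.mul_right ((commute_flipEnd_diff h).mul_right (commute_flipEnd_diff h))

theorem commute_flipEnd_diffCen (h : Commute L (flipEnd shift))
    (h' : Commute L (flipEnd unshift)) : Commute L (flipEnd diffCen) := by
  rw [flipEnd_diffCen]
  exact Commute.sub_right (R := Module.End ℝ squareSummable) (commute_flipEnd_diff h)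
    ((commute_flipEnd_diffTwo h h').smul_right _)

end Commutation

theorem flipEnd_diff_diff (f : squareSummable) :
    flipEnd diff (diff f) = diff (flipEnd diff f) :=
  DFunLike.congr_fun (commute_diff (commute_flipEnd_diff commute_shift_flipEnd_shift)).eq.symm f

theorem flipEnd_diff_diffTwo (f : squareSummable) :
    flipEnd diff (diffTwo f) = diffTwo (flipEnd diff f) :=
  DFunLike.congr_fun (commute_diffTwo (commute_flipEnd_diff commute_shift_flipEnd_shift)
    (commute_flipEnd_diff commute_unshift_flipEnd_shift)).eq.symm f

theorem flipEnd_diff_diffCen (f : squareSummable) :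
    flipEnd diff (diffCen f) = diffCen (flipEnd diff f) :=
  DFunLike.congr_fun (commute_diffCen (commute_flipEnd_diff commute_shift_flipEnd_shift)
    (commute_flipEnd_diff commute_unshift_flipEnd_shift)).eq.symm f

theorem flipEnd_diffTwo_diff (f : squareSummable) :
    flipEnd diffTwo (diff f) = diff (flipEnd diffTwo f) :=
  DFunLike.congr_fun (commute_diff (commute_flipEnd_diffTwo commute_shift_flipEnd_shift
    commute_shift_flipEnd_unshift)).eq.symm f

theorem flipEnd_diffCen_diff (f : squareSummable) :
    flipEnd diffCen (diff f) = diff (flipEnd diffCen f) :=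
  DFunLike.congr_fun (commute_diff (commute_flipEnd_diffCen commute_shift_flipEnd_shift
    commute_shift_flipEnd_unshift)).eq.symm f

theorem flipEnd_diffTwo_diffTwo (f : squareSummable) :
    flipEnd diffTwo (diffTwo f) = diffTwo (flipEnd diffTwo f) :=
  DFunLike.congr_fun (commute_diffTwo
    (commute_flipEnd_diffTwo commute_shift_flipEnd_shift commute_shift_flipEnd_unshift)
    (commute_flipEnd_diffTwo commute_unshift_flipEnd_shift
      commute_unshift_flipEnd_unshift)).eq.symm f

theorem flipEnd_diffCen_diffCen (f : squareSummable) :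
    flipEnd diffCen (diffCen f) = diffCen (flipEnd diffCen f) :=
  DFunLike.congr_fun (commute_diffCen
    (commute_flipEnd_diffCen commute_shift_flipEnd_shift commute_shift_flipEnd_unshift)
    (commute_flipEnd_diffCen commute_unshift_flipEnd_shift
      commute_unshift_flipEnd_unshift)).eq.symm f

/-! ### The weights and summation by parts -/

/-- The weight `(1/2, 1, 1, …)` of the modified energy. -/
noncomputable def halfWeight (j : ℕ) : unitInterval :=
  if j = 0 then ⟨1 / 2, by norm_num, by norm_num⟩ else 1

/-- The weight `(1, 0, 0, …)`, which turns a form into a boundary sum. -/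
def bdryWeight (j : ℕ) : unitInterval := if j = 0 then 1 else 0

theorem form_half (q : ℕ → unitInterval) (f g : squareSummable) :
    form halfWeight q f g = form 1 q f g - 1 / 2 * form bdryWeight q f g := by
  rw [form_apply, form_apply, form_apply, ← tsum_mul_left, ← Summable.tsum_sub]
  · refine tsum_congr fun ⟨j, k⟩ => ?_
    rcases j with _ | j <;> simp [halfWeight, bdryWeight]
    ring
  · exact summable_weighted_mul (fun i => (1 : ℕ → unitInterval) i.1 * q i.2) f g
  · exact (summable_weighted_mul (fun i => bdryWeight i.1 * q i.2) f g).mul_left _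

/-- A sum over a direction splits into its boundary part and the shifted sum. Together
with `form_half` and `form_bdry_diffTwo`, this identity gives all summation by parts formulas by
linear algebra. -/
theorem form_one (q : ℕ → unitInterval) (f g : squareSummable) :
    form 1 q f g = form bdryWeight q f g + form 1 q (shift f) (shift g) := by
  have h1 := summable_weighted_mul (fun i => (1 : ℕ → unitInterval) i.1 * q i.2) f g
  have h2 := summable_weighted_mul (fun i => bdryWeight i.1 * q i.2) f g
  have h3 := summable_weighted_mul (fun i => (1 : ℕ → unitInterval) i.1 * q i.2)
    (shift f) (shift g)
  rw [form_apply, form_apply, form_apply, h1.tsum_prod, h2.tsum_prod, h3.tsum_prod,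
    h1.prod.tsum_eq_zero_add]
  congr 1
  refine Eq.trans ?_ (tsum_eq_single 0 ?_).symm
  · simp [bdryWeight]
  · intro j hj
    simp [bdryWeight, hj]

theorem form_bdry_diffTwo (q : ℕ → unitInterval) (f g : squareSummable) :
    form bdryWeight q (diffTwo f) g = 0 := by
  rw [form_apply, ← tsum_zero]
  refine tsum_congr fun ⟨j, k⟩ => ?_
  rcases j with _ | j
  · simp [diffTwo, unshift]
  · simp [bdryWeight]

theorem shift_eq (f : squareSummable) : shift f = diff f + f := by
  simp [diff]

theorem shift_diffTwo (f : squareSummable) : shift (diffTwo f) = diff (diff f) := rfl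

section SummationByParts

variable (q : ℕ → unitInterval) (f g : squareSummable)

theorem form_half_diffTwo_left : form halfWeight q (diffTwo f) g = form 1 q (diffTwo f) g := by
  rw [form_half, form_bdry_diffTwo]; ring

theorem form_half_diffTwo_right : form halfWeight q f (diffTwo g) = form 1 q f (diffTwo g) := by
  rw [form_comm, form_half_diffTwo_left, form_comm]

theorem form_one_diffTwo_left :
    form 1 q (diffTwo f) g = form 1 q (diff (diff f)) (shift g) := by
  rw [form_one, form_bdry_diffTwo, shift_diffTwo, zero_add]

/-- Summation by parts for the second difference. -/
theorem form_half_diffTwo :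
    form halfWeight q f (diffTwo g)
      = -form 1 q (diff f) (diff g) - form bdryWeight q f (diff g) := by
  have h := form_one q f (diff g)
  rw [form_half_diffTwo_right, form_comm, form_one_diffTwo_left, form_comm]
  rw [shift_eq, shift_eq] at h
  rw [shift_eq]
  simp only [map_add, LinearMap.add_apply] at h ⊢
  linarith

/-- Summation by parts for the centred difference. -/
theorem form_half_diffCen :
    form halfWeight q f (diffCen g) + form halfWeight q (diffCen f) g
      = -form bdryWeight q f g := by
  have h1 := form_half_diffTwo q f g
  have h2 := form_half_diffTwo q g f
  have h3 := form_half q f (diff g)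
  have h4 := form_half q (diff f) g
  have h5 := form_one q f g
  rw [form_comm _ _ g, form_comm 1 q (diff g), form_comm _ _ g] at h2
  rw [shift_eq, shift_eq] at h5
  simp only [diffCen, map_add, map_sub, map_smul, LinearMap.add_apply, LinearMap.sub_apply,
    LinearMap.smul_apply, smul_eq_mul] at h5 ⊢
  linarith

theorem form_half_diffCen_self :
    form halfWeight q f (diffCen f) = -1 / 2 * form bdryWeight q f f := by
  have := form_half_diffCen q f f
  rw [form_comm _ _ (diffCen f)] at this
  linarith

/-- The second differences measure what averaging a forward difference into a centred one loses. -/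
theorem form_half_diffCen_diffCen :
    form halfWeight q (diffCen f) (diffCen f)
      = form 1 q (diff f) (diff f) - 1 / 4 * form halfWeight q (diffTwo f) (diffTwo f) := by
  have h1 := form_half q (diff f) (diff f)
  have h2 := form_one q (diff f) (diff f)
  have h3 : form halfWeight q (diff f) (diffTwo f) = form 1 q (shift (diff f)) (diff (diff f)) := by
    rw [form_comm, form_half_diffTwo_left, form_one_diffTwo_left, form_comm]
  have h4 : form halfWeight q (diffTwo f) (diffTwo f)
      = form 1 q (diff (diff f)) (diff (diff f)) := by
    rw [form_half_diffTwo_left, form_one_diffTwo_left, shift_diffTwo]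
  have h5 := form_comm halfWeight q (diff f) (diffTwo f)
  have h6 := form_comm 1 q (diff f) (diff (diff f))
  rw [shift_eq] at h2 h3
  simp only [diffCen, map_add, map_sub, map_smul, LinearMap.add_apply, LinearMap.sub_apply,
    LinearMap.smul_apply, smul_eq_mul] at h2 h3 ⊢
  linarith

theorem form_half_diffCen_diffTwo :
    form halfWeight q (diffCen f) (diffTwo f) = -1 / 2 * form bdryWeight q (diff f) (diff f) := by
  have h2 := form_one q (diff f) (diff f)
  have h3 : form halfWeight q (diff f) (diffTwo f) = form 1 q (shift (diff f)) (diff (diff f)) := by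
    rw [form_comm, form_half_diffTwo_left, form_one_diffTwo_left, form_comm]
  have h4 : form halfWeight q (diffTwo f) (diffTwo f)
      = form 1 q (diff (diff f)) (diff (diff f)) := by
    rw [form_half_diffTwo_left, form_one_diffTwo_left, shift_diffTwo]
  have h6 := form_comm 1 q (diff f) (diff (diff f))
  rw [shift_eq] at h2 h3
  simp only [diffCen, map_add, map_sub, map_smul, LinearMap.add_apply, LinearMap.sub_apply,
    LinearMap.smul_apply, smul_eq_mul] at h2 h3 ⊢
  linarith

/-! ### Bounds on the forms -/

theorem form_mul_le (p : ℕ → unitInterval) {t : ℝ} (ht : 0 < t) :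
    2 * |form p q f g| ≤ t * form p q f f + t⁻¹ * form p q g g := by
  have h1 := form_self_nonneg p q (t • f + g)
  have h2 := form_self_nonneg p q (t • f - g)
  have h3 := form_comm p q f g
  simp only [map_add, map_sub, map_smul, LinearMap.add_apply, LinearMap.sub_apply,
    LinearMap.smul_apply, smul_eq_mul] at h1 h2
  rw [← h3] at h1 h2
  have key : 2 * |form p q f g| * t ≤ (t * form p q f f + t⁻¹ * form p q g g) * t := by
    rw [show (t * form p q f f + t⁻¹ * form p q g g) * t
      = t * t * form p q f f + form p q g g by field_simp]
    rcases abs_cases (form p q f g) with ⟨h, _⟩ | ⟨h, _⟩ <;> rw [h] <;> linarith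
  exact le_of_mul_le_mul_right key ht

theorem form_add_self_le (p : ℕ → unitInterval) :
    form p q (f + g) (f + g) ≤ 2 * form p q f f + 2 * form p q g g := by
  have := form_self_nonneg p q (f - g)
  simp only [map_add, map_sub, LinearMap.add_apply, LinearMap.sub_apply] at this ⊢
  linarith

theorem form_bdry_le_one : form bdryWeight q f f ≤ form 1 q f f := by
  have := form_self_nonneg 1 q (shift f)
  linarith [form_one q f f]

theorem form_one_le_half : form 1 q f f ≤ 2 * form halfWeight q f f := by
  linarith [form_half q f f, form_bdry_le_one q f]

theorem form_one_shift_le : form 1 q (shift f) (shift f) ≤ form 1 q f f := by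
  linarith [form_one q f f, form_self_nonneg bdryWeight q f]

theorem form_one_diff_le : form 1 q (diff f) (diff f) ≤ 4 * form 1 q f f := by
  have h1 := form_one_shift_le q f
  have h2 := form_self_nonneg 1 q (shift f + f)
  have h3 : diff f = shift f - f := rfl
  rw [h3]
  simp only [map_add, map_sub, LinearMap.add_apply, LinearMap.sub_apply] at h2 ⊢
  linarith

theorem form_half_diffCen_le :
    form halfWeight q (diffCen f) (diffCen f) ≤ form 1 q (diff f) (diff f) := by
  linarith [form_half_diffCen_diffCen q f, form_self_nonneg halfWeight q (diffTwo f)]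

theorem form_half_diffTwo_le :
    form halfWeight q (diffTwo f) (diffTwo f) ≤ 4 * form 1 q (diff f) (diff f) := by
  rw [form_half_diffTwo_left, form_one_diffTwo_left, shift_diffTwo]
  exact form_one_diff_le q (diff f)

theorem form_bdry_le_half : form bdryWeight q f f ≤ 2 * form halfWeight q f f :=
  (form_bdry_le_one q f).trans (form_one_le_half q f)

theorem form_one_diff_le_half :
    form 1 q (diff f) (diff f) ≤ 8 * form halfWeight q f f := by
  linarith [form_one_diff_le q f, form_one_le_half q f]

end SummationByParts

/-! ### Summation by parts in the second index -/

section SecondIndex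

variable (p : ℕ → unitInterval) (f g : squareSummable)

theorem form_half_flip_diffTwo :
    form p halfWeight f (flipEnd diffTwo g)
      = -form p 1 (flipEnd diff f) (flipEnd diff g)
        - form p bdryWeight f (flipEnd diff g) := by
  rw [← form_transpose halfWeight p, ← form_transpose 1 p, ← form_transpose bdryWeight p]
  exact form_half_diffTwo p (transpose f) (transpose g)

theorem form_half_flip_diffCen_self :
    form p halfWeight f (flipEnd diffCen f) = -1 / 2 * form p bdryWeight f f := by
  rw [← form_transpose halfWeight p, ← form_transpose bdryWeight p]
  exact form_half_diffCen_self p (transpose f)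

theorem form_flip_bdry_le_one : form p bdryWeight f f ≤ form p 1 f f := by
  rw [← form_transpose 1 p, ← form_transpose bdryWeight p]
  exact form_bdry_le_one p (transpose f)

theorem form_flip_bdry_le_half : form p bdryWeight f f ≤ 2 * form p halfWeight f f := by
  rw [← form_transpose halfWeight p, ← form_transpose bdryWeight p]
  exact form_bdry_le_half p (transpose f)

theorem form_one_flip_diff_le_half :
    form p 1 (flipEnd diff f) (flipEnd diff f) ≤ 8 * form p halfWeight f f := by
  rw [← form_transpose 1 p, ← form_transpose halfWeight p]
  exact form_one_diff_le_half p (transpose f)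

theorem form_half_flip_diffCen_le :
    form p halfWeight (flipEnd diffCen f) (flipEnd diffCen f)
      ≤ form p 1 (flipEnd diff f) (flipEnd diff f) := by
  rw [← form_transpose 1 p, ← form_transpose halfWeight p]
  exact form_half_diffCen_le p (transpose f)

theorem form_half_flip_diffTwo_le :
    form p halfWeight (flipEnd diffTwo f) (flipEnd diffTwo f)
      ≤ 4 * form p 1 (flipEnd diff f) (flipEnd diff f) := by
  rw [← form_transpose 1 p, ← form_transpose halfWeight p]
  exact form_half_diffTwo_le p (transpose f)

end SecondIndex

/-! ### The mixed terms of the energy balance -/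

section MixedTerms

variable (u : squareSummable)

/-- The squared norm of the mixed first difference. The stabilizer dissipates this quantity. -/
noncomputable def mixedNorm : ℝ :=
  form 1 1 (diff (flipEnd diff u)) (diff (flipEnd diff u))

theorem mixedNorm_nonneg : 0 ≤ mixedNorm u := form_self_nonneg _ _ _

theorem mixedNorm_transpose : mixedNorm (transpose u) = mixedNorm u := by
  rw [mixedNorm, mixedNorm, flipEnd_transpose, ← transpose_flipEnd, form_transpose,
    flipEnd_diff_diff]

theorem form_diffCen_cross :
    form halfWeight halfWeight u (diffCen (flipEnd diffCen u))
      + form halfWeight halfWeight (diffCen u) (flipEnd diffCen u)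
      = 1 / 2 * form bdryWeight bdryWeight u u := by
  rw [form_half_diffCen, form_half_flip_diffCen_self]
  ring

/-- The stabilizer is dissipative up to boundary terms. -/
theorem le_form_stabilizer :
    5 / 8 * mixedNorm u
        - 20 * (form bdryWeight halfWeight u u + form halfWeight bdryWeight u u)
      ≤ form halfWeight halfWeight u (diffTwo (flipEnd diffTwo u)) := by
  have e : form halfWeight halfWeight u (diffTwo (flipEnd diffTwo u))
      = mixedNorm u + form 1 bdryWeight (diff u) (diff (flipEnd diff u))
        + form bdryWeight 1 (flipEnd diff u) (diff (flipEnd diff u))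
        + form bdryWeight bdryWeight u (diff (flipEnd diff u)) := by
    rw [form_half_diffTwo, ← flipEnd_diffTwo_diff, form_half_flip_diffTwo, form_half_flip_diffTwo,
      flipEnd_diff_diff, mixedNorm]
    ring
  have h1 := form_mul_le bdryWeight (diff u) (diff (flipEnd diff u)) 1 four_pos
  have h2 := form_mul_le 1 (flipEnd diff u) (diff (flipEnd diff u)) bdryWeight four_pos
  have h3 := form_mul_le bdryWeight u (diff (flipEnd diff u)) bdryWeight four_pos
  have n1 : form 1 bdryWeight (diff (flipEnd diff u)) (diff (flipEnd diff u)) ≤ mixedNorm u :=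
    form_flip_bdry_le_one _ _
  have n2 : form bdryWeight 1 (diff (flipEnd diff u)) (diff (flipEnd diff u)) ≤ mixedNorm u :=
    form_bdry_le_one _ _
  have n3 := form_flip_bdry_le_one bdryWeight (diff (flipEnd diff u))
  have b1 := form_one_diff_le_half bdryWeight u
  have b2 := form_one_flip_diff_le_half bdryWeight u
  have b3 := form_flip_bdry_le_half bdryWeight u
  have x0 := form_self_nonneg bdryWeight halfWeight u
  have y0 := form_self_nonneg halfWeight bdryWeight u
  have a1 := neg_abs_le (form 1 bdryWeight (diff u) (diff (flipEnd diff u)))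
  have a2 := neg_abs_le (form bdryWeight 1 (flipEnd diff u) (diff (flipEnd diff u)))
  have a3 := neg_abs_le (form bdryWeight bdryWeight u (diff (flipEnd diff u)))
  norm_num at h1 h2 h3
  linarith

theorem form_diffCen_diffTwo_cross :
    form halfWeight halfWeight (flipEnd diffCen u) (diffTwo u)
        + 2 * form halfWeight halfWeight (diffCen u) (diffCen (flipEnd diffCen u))
      = 1 / 2 * form 1 bdryWeight (diff u) (diff u)
        - form bdryWeight halfWeight (flipEnd diffCen u) (diff u)
        - form halfWeight bdryWeight (diffCen u) (diffCen u) := by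
  rw [form_half_diffTwo, form_comm 1, ← flipEnd_diffCen_diff, form_half_flip_diffCen_self,
    ← flipEnd_diffCen_diffCen, form_half_flip_diffCen_self]
  ring

/-- The third order terms mixing both directions with two differences in the first one. The
boundary norm of `diff u` on the right is controlled by the third order dissipation
of the one-dimensional scheme. -/
theorem cubic_cross_le {A B : ℝ} (hA : 0 < A) (hB : 0 < B) :
    A ^ 2 * B * (form halfWeight halfWeight (flipEnd diffCen u) (diffTwo u)
        + 2 * form halfWeight halfWeight (diffCen u) (diffCen (flipEnd diffCen u)))
      ≤ 4 * A ^ 2 * B * form halfWeight bdryWeight u u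
        + 24 * A * B ^ 2 * form bdryWeight halfWeight u u
        + A ^ 3 / 12 * form bdryWeight halfWeight (diff u) (diff u) := by
  rw [form_diffCen_diffTwo_cross]
  have h1 := form_one_diff_le_half bdryWeight u
  have h2 := form_self_nonneg halfWeight bdryWeight (diffCen u)
  have h3 := (form_half_flip_diffCen_le bdryWeight u).trans
    (form_one_flip_diff_le_half bdryWeight u)
  -- The weight `6 B / A` leaves exactly `A ^ 3 / 12` in front of the norm of `diff u`.
  have h4 := form_mul_le halfWeight (flipEnd diffCen u) (diff u) bdryWeight
    (t := 6 * B / A) (by positivity)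
  have h5 := neg_abs_le (form bdryWeight halfWeight (flipEnd diffCen u) (diff u))
  set P := form bdryWeight halfWeight (flipEnd diffCen u) (flipEnd diffCen u)
  set X := form bdryWeight halfWeight u u
  set Y := form halfWeight bdryWeight u u
  set Z := form bdryWeight halfWeight (diff u) (diff u)
  have h6 : 6 * B / A * P ≤ 6 * B / A * (8 * X) := mul_le_mul_of_nonneg_left h3 (by positivity)
  calc _ ≤ A ^ 2 * B * (4 * Y + 1 / 2 * (6 * B / A * (8 * X) + (6 * B / A)⁻¹ * Z)) :=
        mul_le_mul_of_nonneg_left (by linarith) (by positivity)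
    _ = _ := by field_simp; ring

/-- The interaction of the transport term with the stabilizer. -/
theorem le_form_diffCen_stabilizer :
    -(4 * form halfWeight bdryWeight u u + 2 * mixedNorm u)
      ≤ form halfWeight halfWeight (diffCen u) (diffTwo (flipEnd diffTwo u)) := by
  rw [← flipEnd_diffTwo_diffTwo, form_half_flip_diffTwo, flipEnd_diff_diffCen,
    flipEnd_diff_diffTwo, form_half_diffCen_diffTwo]
  have h1 := form_self_nonneg bdryWeight 1 (diff (flipEnd diff u))
  have h2 := form_mul_le bdryWeight (diffCen u) (diffTwo (flipEnd diff u)) halfWeight one_pos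
  have h3 := form_half_diffTwo_le bdryWeight (flipEnd diff u)
  have h4 : form 1 bdryWeight (diff (flipEnd diff u)) (diff (flipEnd diff u)) ≤ mixedNorm u :=
    form_flip_bdry_le_one _ _
  have h5 := (form_half_diffCen_le bdryWeight u).trans (form_one_diff_le_half bdryWeight u)
  have h6 := le_abs_self (form halfWeight bdryWeight (diffCen u) (diffTwo (flipEnd diff u)))
  norm_num at h2
  linarith

theorem form_diffCen_diffCen_le :
    form halfWeight halfWeight (diffCen (flipEnd diffCen u)) (diffCen (flipEnd diffCen u))
      ≤ mixedNorm u := by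
  refine (form_half_diffCen_le _ _).trans ?_
  rw [← flipEnd_diffCen_diff]
  refine (form_half_flip_diffCen_le _ _).trans ?_
  rw [flipEnd_diff_diff, mixedNorm]

theorem form_stabilizer_le :
    form halfWeight halfWeight (diffTwo (flipEnd diffTwo u)) (diffTwo (flipEnd diffTwo u))
      ≤ 16 * mixedNorm u := by
  have h1 := form_half_diffTwo_le halfWeight (flipEnd diffTwo u)
  have h2 := form_half_flip_diffTwo_le 1 (diff u)
  rw [flipEnd_diff_diff] at h2
  rw [← flipEnd_diffTwo_diff] at h1
  rw [mixedNorm]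
  linarith

end MixedTerms

/-! ### The energy estimate for one step -/

/-- The terms of the scheme carrying two or more differences. -/
noncomputable def higherOrder (α β : ℝ) (u : squareSummable) : squareSummable :=
  ((α ^ 2 / 2) • diffTwo u + (β ^ 2 / 2) • flipEnd diffTwo u)
    + ((α * β) • diffCen (flipEnd diffCen u)
      + (-(α ^ 2 + β ^ 2) / 8) • diffTwo (flipEnd diffTwo u))

/-- One time step of the Lax–Wendroff scheme with stabilizer. -/
noncomputable def stepOp (α β : ℝ) (u : squareSummable) : squareSummable :=
  u + (((-α) • diffCen u + (-β) • flipEnd diffCen u) + higherOrder α β u)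

theorem form_higherOrder (α β : ℝ) (f u : squareSummable) :
    form halfWeight halfWeight f (higherOrder α β u)
      = α ^ 2 / 2 * form halfWeight halfWeight f (diffTwo u)
        + β ^ 2 / 2 * form halfWeight halfWeight f (flipEnd diffTwo u)
        + α * β * form halfWeight halfWeight f (diffCen (flipEnd diffCen u))
        - (α ^ 2 + β ^ 2) / 8
          * form halfWeight halfWeight f (diffTwo (flipEnd diffTwo u)) := by
  simp only [higherOrder, map_add, map_smul, smul_eq_mul]
  ring

theorem form_higherOrder_self_le (α β : ℝ) (u : squareSummable) :
    form halfWeight halfWeight (higherOrder α β u) (higherOrder α β u)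
      ≤ α ^ 4 * form halfWeight halfWeight (diffTwo u) (diffTwo u)
        + β ^ 4 * form halfWeight halfWeight (flipEnd diffTwo u) (flipEnd diffTwo u)
        + 2 * (α ^ 2 + β ^ 2) ^ 2 * mixedNorm u := by
  unfold higherOrder
  refine (form_add_self_le _ _ _ _).trans ?_
  have h1 := form_add_self_le halfWeight ((α ^ 2 / 2) • diffTwo u)
    ((β ^ 2 / 2) • flipEnd diffTwo u) halfWeight
  have h2 := form_add_self_le halfWeight ((α * β) • diffCen (flipEnd diffCen u))
    ((-(α ^ 2 + β ^ 2) / 8) • diffTwo (flipEnd diffTwo u)) halfWeight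
  generalize form halfWeight halfWeight ((α ^ 2 / 2) • diffTwo u + (β ^ 2 / 2) • flipEnd diffTwo u)
    ((α ^ 2 / 2) • diffTwo u + (β ^ 2 / 2) • flipEnd diffTwo u) = E1 at *
  generalize form halfWeight halfWeight ((α * β) • diffCen (flipEnd diffCen u)
      + (-(α ^ 2 + β ^ 2) / 8) • diffTwo (flipEnd diffTwo u))
    ((α * β) • diffCen (flipEnd diffCen u)
      + (-(α ^ 2 + β ^ 2) / 8) • diffTwo (flipEnd diffTwo u)) = E2 at *
  simp only [map_smul, LinearMap.smul_apply, smul_eq_mul] at h1 h2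
  have h3 := mul_le_mul_of_nonneg_left (form_diffCen_diffCen_le u) (sq_nonneg (α * β))
  have h4 := mul_le_mul_of_nonneg_left (form_stabilizer_le u) (sq_nonneg ((α ^ 2 + β ^ 2) / 8))
  have h5 := mul_nonneg (sq_nonneg (α ^ 2 - β ^ 2)) (mixedNorm_nonneg u)
  nlinarith

/-- The terms of higher order in the velocities are small compared with the dissipation. -/
theorem coefficients_nonneg {A B : ℝ} (hA : 0 < A) (hB : 0 < B) (h : A ^ 2 + B ^ 2 ≤ A / 300)
    (h' : A ^ 2 + B ^ 2 ≤ B / 300) :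
    0 ≤ 5 / 32 * (A ^ 2 + B ^ 2) - (A ^ 2 + B ^ 2) * (A + B) / 2 - 2 * (A ^ 2 + B ^ 2) ^ 2 ∧
      0 ≤ 1 / 5 * A - 2 * (A * B) - 5 * (A ^ 2 + B ^ 2) - 28 * (A * B ^ 2)
        - (A ^ 2 + B ^ 2) * B ∧
      A ^ 4 ≤ 3 / 20 * A ^ 2 := by
  have bA : A ≤ 1 / 300 := by nlinarith [sq_nonneg B]
  have bB : B ≤ 1 / 300 := by nlinarith [sq_nonneg A]
  have hs : 0 ≤ A ^ 2 + B ^ 2 := by positivity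
  have hAB : 2 * (A * B) ≤ A ^ 2 + B ^ 2 := by linarith [sq_nonneg (A - B)]
  have hABB : A * B ^ 2 ≤ 1 / 300 * B ^ 2 := mul_le_mul_of_nonneg_right bA (sq_nonneg B)
  have hsA : (A ^ 2 + B ^ 2) * A ≤ (A ^ 2 + B ^ 2) * (1 / 300) := mul_le_mul_of_nonneg_left bA hs
  have hsB : (A ^ 2 + B ^ 2) * B ≤ (A ^ 2 + B ^ 2) * (1 / 300) := mul_le_mul_of_nonneg_left bB hs
  have hss : (A ^ 2 + B ^ 2) * (A ^ 2 + B ^ 2) ≤ (A ^ 2 + B ^ 2) * (1 / 300) :=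
    mul_le_mul_of_nonneg_left (by linarith) hs
  have hA4 : A ^ 2 * A ^ 2 ≤ 3 / 20 * A ^ 2 :=
    mul_le_mul_of_nonneg_right (by linarith [sq_nonneg B]) (sq_nonneg A)
  refine ⟨?_, ?_, ?_⟩
  · linarith
  · linarith [sq_nonneg A, sq_nonneg B]
  · linarith

/-- The energy balance of one step, for velocities `-A` and `-B`. The smallness assumption says
that the second order terms are dominated by the boundary dissipation of order one. -/
theorem form_stepOp_le {A B : ℝ} (hA : 0 < A) (hB : 0 < B) (h : A ^ 2 + B ^ 2 ≤ A / 300)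
    (h' : A ^ 2 + B ^ 2 ≤ B / 300) (u : squareSummable) :
    form halfWeight halfWeight (stepOp (-A) (-B) u) (stepOp (-A) (-B) u)
        - form halfWeight halfWeight u u
        + 1 / 10 * A ^ 2 * form halfWeight halfWeight (diffTwo u) (diffTwo u)
        + 1 / 10 * B ^ 2 * form halfWeight halfWeight (flipEnd diffTwo u) (flipEnd diffTwo u)
        + 1 / 5 * A * form bdryWeight halfWeight u u
        + 1 / 5 * B * form halfWeight bdryWeight u u ≤ 0 := by
  -- The boundary term of order two is dominated by the dissipation of orders one and three. The
  -- factor `5 / 12` leaves `1 / 2 - 5 / 12 = 1 / 12`, which `cubic_cross_le` uses up.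
  have quad : ∀ {C : ℝ}, 0 < C → ∀ v : squareSummable,
      -C ^ 2 * form bdryWeight halfWeight v (diff v)
        ≤ 3 / 5 * C * form bdryWeight halfWeight v v
          + 5 / 12 * C ^ 3 * form bdryWeight halfWeight (diff v) (diff v) := by
    intro C hC v
    have h1 := form_mul_le halfWeight v (diff v) bdryWeight (t := 6 / 5 / C) (by positivity)
    have h2 := neg_abs_le (form bdryWeight halfWeight v (diff v))
    calc _ = C ^ 2 * (-form bdryWeight halfWeight v (diff v)) := by ring
      _ ≤ C ^ 2 * (1 / 2 * (6 / 5 / C * form bdryWeight halfWeight v v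
          + (6 / 5 / C)⁻¹ * form bdryWeight halfWeight (diff v) (diff v))) :=
        mul_le_mul_of_nonneg_left (by linarith) (by positivity)
      _ = _ := by field_simp; ring
  -- The one-dimensional identities, stated for an arbitrary array so that they also apply to the
  -- transpose of `u`.
  have dir : ∀ v : squareSummable,
      form halfWeight halfWeight v (diffCen v) = -1 / 2 * form bdryWeight halfWeight v v ∧
      form halfWeight halfWeight (diffCen v) (diffCen v)
          + form halfWeight halfWeight v (diffTwo v)
        = -1 / 4 * form halfWeight halfWeight (diffTwo v) (diffTwo v)
          - form bdryWeight halfWeight v (diff v) ∧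
      form halfWeight halfWeight (diffCen v) (diffTwo v)
        = -1 / 2 * form bdryWeight halfWeight (diff v) (diff v) := fun v =>
    ⟨form_half_diffCen_self _ _, by rw [form_half_diffCen_diffCen, form_half_diffTwo _ v v]; ring,
      form_half_diffCen_diffTwo _ _⟩
  obtain ⟨dx1, dx2, dx3⟩ := dir u
  obtain ⟨dy1, dy2, dy3⟩ := dir (transpose u)
  have qx := quad hA u
  have qy := quad hB (transpose u)
  have cx := cubic_cross_le u hA hB
  have cy := cubic_cross_le (transpose u) hB hA
  have sx := le_form_diffCen_stabilizer u
  have sy := le_form_diffCen_stabilizer (transpose u)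
  have cr := form_diffCen_cross u
  have st := le_form_stabilizer u
  have ho := form_higherOrder_self_le (-A) (-B) u
  have co := form_flip_bdry_le_half bdryWeight u
  rw [mixedNorm_transpose] at sy
  have t1 : ∀ f, diff (transpose f) = transpose (flipEnd diff f) := fun _ => rfl
  have t2 : ∀ f, diffTwo (transpose f) = transpose (flipEnd diffTwo f) := fun _ => rfl
  have t3 : ∀ f, diffCen (transpose f) = transpose (flipEnd diffCen f) := fun _ => rfl
  simp only [flipEnd_transpose, t1, t2, t3, form_transpose, flipEnd_diffCen_diffCen,
    flipEnd_diffTwo_diffTwo] at dy1 dy2 dy3 qy cy sy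
  have e1 := form_higherOrder (-A) (-B) u u
  have e2 := form_higherOrder (-A) (-B) (diffCen u) u
  have e3 := form_higherOrder (-A) (-B) (flipEnd diffCen u) u
  have c1 := form_comm halfWeight halfWeight u (diffCen u)
  have c2 := form_comm halfWeight halfWeight u (flipEnd diffCen u)
  have c3 := form_comm halfWeight halfWeight u (higherOrder (-A) (-B) u)
  have c4 := form_comm halfWeight halfWeight (diffCen u) (higherOrder (-A) (-B) u)
  have c5 := form_comm halfWeight halfWeight (flipEnd diffCen u) (higherOrder (-A) (-B) u)
  have c6 := form_comm halfWeight halfWeight (diffCen u) (flipEnd diffCen u)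
  have n1 := mixedNorm_nonneg u
  have n2 := form_self_nonneg halfWeight halfWeight (diffTwo u)
  have n3 := form_self_nonneg halfWeight halfWeight (flipEnd diffTwo u)
  have n4 := form_self_nonneg bdryWeight halfWeight u
  have n5 := form_self_nonneg halfWeight bdryWeight u
  simp only [stepOp, map_add, map_smul, LinearMap.add_apply, LinearMap.smul_apply, smul_eq_mul,
    neg_neg]
  rw [← c1, ← c2, ← c3, ← c4, ← c5, ← c6, e1, e2, e3, dx1, dy1]
  obtain ⟨hN, hX, hA4⟩ := coefficients_nonneg hA hB h h'
  obtain ⟨-, hY, hB4⟩ := coefficients_nonneg hB hA (by linarith) (by linarith)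
  have kN := mul_nonneg hN n1
  have kX := mul_nonneg hX n4
  have kY := mul_nonneg hY n5
  have kAB := mul_nonneg (mul_pos hA hB).le n5
  have st' := mul_le_mul_of_nonneg_left st (show 0 ≤ (A ^ 2 + B ^ 2) / 4 by positivity)
  have sx' := mul_le_mul_of_nonneg_left sx (show 0 ≤ (A ^ 2 + B ^ 2) * A / 4 by positivity)
  have sy' := mul_le_mul_of_nonneg_left sy (show 0 ≤ (A ^ 2 + B ^ 2) * B / 4 by positivity)
  have co' := mul_le_mul_of_nonneg_left co (show 0 ≤ A * B by positivity)
  have kGA := mul_le_mul_of_nonneg_right hA4 n2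
  have kGB := mul_le_mul_of_nonneg_right hB4 n3
  linear_combination kN + kX + kY + 2 * kAB + st' + sx' + sy' + co' + kGA + kGB + qx + qy + cx
    + cy + ho + A ^ 2 * dx2 + B ^ 2 * dy2 + A ^ 3 * dx3 + B ^ 3 * dy3 + 2 * A * B * cr

/-! ### Identification of the scheme, the energy and the sums -/

theorem mem_squareSummable_iff (f : ℕ × ℕ → ℝ) : f ∈ squareSummable ↔ Memℓp f 2 := by
  rw [memℓp_gen_iff (by norm_num)]
  simp [squareSummable]

theorem ghost_natCast (v : ℕ → ℕ → ℝ) (j k : ℕ) : ghost v j k = v j k := rfl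

theorem ghost_neg_one_natCast (v : ℕ → ℕ → ℝ) (k : ℕ) :
    ghost v (-1) k = 2 * v 0 k - v 1 k := rfl

theorem ghost_natCast_neg_one (v : ℕ → ℕ → ℝ) (j : ℕ) :
    ghost v j (-1) = 2 * v j 0 - v j 1 := rfl

theorem ghost_neg_one_neg_one (v : ℕ → ℕ → ℝ) :
    ghost v (-1) (-1) = 4 * v 0 0 - 2 * v 1 0 - 2 * v 0 1 + v 1 1 := rfl

section Evaluation

variable (f : squareSummable) (j k : ℕ)

theorem diffTwo_zero : (diffTwo f).1 (0, k) = 0 := rfl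

theorem diffTwo_succ :
    (diffTwo f).1 (j + 1, k) = f.1 (j + 2, k) - 2 * f.1 (j + 1, k) + f.1 (j, k) := by
  change (f.1 (j + 2, k) - f.1 (j + 1, k)) - (f.1 (j + 1, k) - f.1 (j, k)) = _
  ring

theorem diffCen_zero : (diffCen f).1 (0, k) = f.1 (1, k) - f.1 (0, k) := by
  change f.1 (1, k) - f.1 (0, k) - 1 / 2 * 0 = _
  ring

theorem diffCen_succ : (diffCen f).1 (j + 1, k) = (f.1 (j + 2, k) - f.1 (j, k)) / 2 := by
  change f.1 (j + 2, k) - f.1 (j + 1, k) - 1 / 2 * (diffTwo f).1 (j + 1, k) = _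
  rw [diffTwo_succ]
  ring

theorem flip_diffTwo_zero : (flipEnd diffTwo f).1 (j, 0) = 0 := rfl

theorem flip_diffTwo_succ :
    (flipEnd diffTwo f).1 (j, k + 1) = f.1 (j, k + 2) - 2 * f.1 (j, k + 1) + f.1 (j, k) :=
  diffTwo_succ (transpose f) k j

theorem flip_diffCen_zero : (flipEnd diffCen f).1 (j, 0) = f.1 (j, 1) - f.1 (j, 0) :=
  diffCen_zero (transpose f) j

theorem flip_diffCen_succ :
    (flipEnd diffCen f).1 (j, k + 1) = (f.1 (j, k + 2) - f.1 (j, k)) / 2 :=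
  diffCen_succ (transpose f) k j

/-- Because the ghost values are tensor products of one-dimensional extrapolations, the scheme is a
polynomial in the one-dimensional difference operators, also on the edges and at the corner. -/
theorem stepOp_apply (α β : ℝ) :
    (stepOp α β f).1 (j, k)
      = laxWendroff α β (ghost fun j k => f.1 (j, k)) (j : ℤ) (k : ℤ) := by
  have e : (stepOp α β f).1 (j, k) = f.1 (j, k) + ((-α * (diffCen f).1 (j, k)
      + -β * (flipEnd diffCen f).1 (j, k)) + ((α ^ 2 / 2 * (diffTwo f).1 (j, k)
      + β ^ 2 / 2 * (flipEnd diffTwo f).1 (j, k))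
      + (α * β * (diffCen (flipEnd diffCen f)).1 (j, k)
      + -(α ^ 2 + β ^ 2) / 8 * (diffTwo (flipEnd diffTwo f)).1 (j, k)))) := rfl
  have s1 : ∀ i : ℕ, ((i + 1 : ℕ) : ℤ) + 1 = ((i + 2 : ℕ) : ℤ) := fun i => by push_cast; ring
  have s2 : ∀ i : ℕ, ((i + 1 : ℕ) : ℤ) - 1 = (i : ℤ) := fun i => by push_cast; ring
  have s3 : ((0 : ℕ) : ℤ) + 1 = ((1 : ℕ) : ℤ) := rfl
  have s4 : ((0 : ℕ) : ℤ) - 1 = -1 := rfl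
  rw [e]
  rcases j with _ | j <;> rcases k with _ | k <;>
    simp only [laxWendroff, s1, s2, s3, s4, ghost_natCast, ghost_neg_one_natCast,
      ghost_natCast_neg_one, ghost_neg_one_neg_one, diffTwo_zero, diffTwo_succ, diffCen_zero,
      diffCen_succ, flip_diffTwo_zero, flip_diffTwo_succ, flip_diffCen_zero,
      flip_diffCen_succ] <;> ring

end Evaluation

theorem form_flip_one (p : ℕ → unitInterval) (f g : squareSummable) :
    form p 1 f g = form p bdryWeight f g + form p 1 (flipEnd shift f) (flipEnd shift g) := by
  rw [← form_transpose 1 p, ← form_transpose bdryWeight p, ← form_transpose 1 p (flipEnd shift f)]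
  exact form_one p (transpose f) (transpose g)

theorem form_flip_half (p : ℕ → unitInterval) (f g : squareSummable) :
    form p halfWeight f g = form p 1 f g - 1 / 2 * form p bdryWeight f g := by
  rw [← form_transpose 1 p, ← form_transpose bdryWeight p, ← form_transpose halfWeight p]
  exact form_half p (transpose f) (transpose g)

theorem form_one_one (f : squareSummable) : form 1 1 f f = ∑' p : ℕ × ℕ, f.1 p ^ 2 :=
  tsum_congr fun p => by simp [sq]

theorem form_bdry_one (f : squareSummable) :
    form bdryWeight 1 f f = ∑' k : ℕ, f.1 (0, k) ^ 2 := by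
  rw [form_apply, Summable.tsum_prod
    (summable_weighted_mul (fun i => bdryWeight i.1 * (1 : ℕ → unitInterval) i.2) f f)]
  refine (tsum_eq_single 0 ?_).trans ?_
  · intro j hj
    simp [bdryWeight, hj]
  · simp [bdryWeight, sq]

theorem form_one_bdry (f : squareSummable) :
    form 1 bdryWeight f f = ∑' j : ℕ, f.1 (j, 0) ^ 2 := by
  rw [← form_transpose bdryWeight 1]
  exact form_bdry_one (transpose f)

theorem form_bdry_bdry (f : squareSummable) : form bdryWeight bdryWeight f f = f.1 (0, 0) ^ 2 := by
  rw [form_apply]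
  refine (tsum_eq_single (0, 0) ?_).trans ?_
  · rintro ⟨_ | j, _ | k⟩ h <;> simp [bdryWeight] at h ⊢
  · simp [bdryWeight, sq]

theorem energy_eq_form (f : squareSummable) :
    energy (fun j k => f.1 (j, k)) = form halfWeight halfWeight f f := by
  have e1 : ∑' p : ℕ × ℕ, f.1 (p.1 + 1, p.2 + 1) ^ 2
      = form 1 1 (flipEnd shift (shift f)) (flipEnd shift (shift f)) :=
    (form_one_one (flipEnd shift (shift f))).symm
  have e2 : ∑' k : ℕ, f.1 (0, k + 1) ^ 2 = form bdryWeight 1 (flipEnd shift f) (flipEnd shift f) :=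
    (form_bdry_one (flipEnd shift f)).symm
  have e3 : ∑' j : ℕ, f.1 (j + 1, 0) ^ 2 = form 1 bdryWeight (shift f) (shift f) :=
    (form_one_bdry (shift f)).symm
  rw [energy, e1, e2, e3, ← form_bdry_bdry]
  linarith [form_half halfWeight f f, form_flip_half 1 f f, form_flip_half bdryWeight f f,
    form_one 1 f f, form_flip_one bdryWeight f f, form_flip_one 1 (shift f) (shift f),
    form_one bdryWeight f f]

theorem form_interior_le (f : squareSummable) :
    ∑' p : ℕ × ℕ, f.1 (p.1 + 1, p.2 + 1) ^ 2 ≤ form halfWeight halfWeight f f := by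
  have e1 : ∑' p : ℕ × ℕ, f.1 (p.1 + 1, p.2 + 1) ^ 2
      = form 1 1 (flipEnd shift (shift f)) (flipEnd shift (shift f)) :=
    (form_one_one (flipEnd shift (shift f))).symm
  rw [e1]
  have h1 := form_flip_one 1 (shift f) (shift f)
  have h2 := form_flip_half 1 (shift f) (shift f)
  have h3 := form_self_nonneg 1 bdryWeight (shift f)
  have h4 := form_half halfWeight f f
  have h5 := form_one halfWeight f f
  have h6 := form_self_nonneg bdryWeight halfWeight f
  linarith

theorem numSol_mem {a b lam mu : ℝ} {u0 : ℕ → ℕ → ℝ} (h0 : Memℓp (Function.uncurry u0) 2)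
    (n : ℕ) : Memℓp (Function.uncurry (numSol a b lam mu u0 n)) 2 := by
  induction n with
  | zero => exact h0
  | succ n ih =>
    rw [← mem_squareSummable_iff] at ih ⊢
    have : Function.uncurry (numSol a b lam mu u0 (n + 1))
        = (stepOp (lam * a) (mu * b) ⟨_, ih⟩).1 := by
      ext ⟨j, k⟩
      exact (stepOp_apply ⟨_, ih⟩ j k _ _).symm
    rw [this]
    exact (stepOp (lam * a) (mu * b) ⟨_, ih⟩).2

/-- This is where comparable velocities are needed: the order two terms of one velocity have to be
dominated by the boundary dissipation, of order one, of the other. -/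
theorem sq_add_sq_le_of_comparable {A B M r : ℝ} (hA : 0 < A) (hB : 0 < B) (hr : 0 < r)
    (hBA : B ≤ M * A) (hM : r * (1 + M) = 1 / 300) (h : A ^ 2 + B ^ 2 ≤ r ^ 2) :
    A ^ 2 + B ^ 2 ≤ A / 300 := by
  have h1 : A ≤ r := le_of_sq_le_sq (by linarith [sq_nonneg B]) hr.le
  have h2 : B ≤ r := le_of_sq_le_sq (by linarith [sq_nonneg A]) hr.le
  calc A ^ 2 + B ^ 2 = A * A + B * B := by ring
    _ ≤ r * A + r * (M * A) := add_le_add (mul_le_mul_of_nonneg_right h1 hA.le)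
        (mul_le_mul h2 hBA hB.le hr.le)
    _ = r * (1 + M) * A := by ring
    _ = A / 300 := by rw [hM]; ring

theorem theorem1 (M : ℝ) (hM : 0 < M) :
    ∃ ε : ℝ, 0 < ε ∧
      ∀ (a b lam mu : ℝ), a < 0 → b < 0 → 0 < lam → 0 < mu →
        lam * |a| ≤ M * (mu * |b|) → mu * |b| ≤ M * (lam * |a|) →
        (lam * a) ^ 2 + (mu * b) ^ 2 ≤ ε →
        ∀ u0 : ℕ → ℕ → ℝ, Memℓp (Function.uncurry u0) 2 →
          ∀ u : ℕ → ℕ → ℕ → ℝ, u = numSol a b lam mu u0 →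
            ∀ n : ℕ,
              Memℓp (Function.uncurry (u n)) 2 ∧
              energy (u (n + 1)) - energy (u n)
                + 1 / 10 * (lam * a) ^ 2 *
                    (∑' p : ℕ × ℕ, (u n p.1 (p.2 + 1) - 2 * u n (p.1 + 1) (p.2 + 1)
                      + u n (p.1 + 2) (p.2 + 1)) ^ 2)
                + 1 / 10 * (mu * b) ^ 2 *
                    (∑' p : ℕ × ℕ, (u n (p.1 + 1) p.2 - 2 * u n (p.1 + 1) (p.2 + 1)
                      + u n (p.1 + 1) (p.2 + 2)) ^ 2)
                + 1 / 10 * (lam * |a|) * (∑' k : ℕ, u n 0 k ^ 2)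
                + 1 / 10 * (mu * |b|) * (∑' j : ℕ, u n j 0 ^ 2) ≤ 0 := by
  -- With this `ε` both `λ|a|` and `μ|b|` are at most `1 / (300 (1 + M))`.
  refine ⟨(1 / (300 * (1 + M))) ^ 2, by positivity, ?_⟩
  rintro a b lam mu ha hb hlam hmu hab hba hsmall u0 hu0 u rfl n
  have hmem := numSol_mem (a := a) (b := b) (lam := lam) (mu := mu) hu0 n
  refine ⟨hmem, ?_⟩
  have hA : 0 < lam * |a| := mul_pos hlam (abs_pos.2 ha.ne)
  have hB : 0 < mu * |b| := mul_pos hmu (abs_pos.2 hb.ne)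
  have ea : lam * a = -(lam * |a|) := by rw [abs_of_neg ha]; ring
  have eb : mu * b = -(mu * |b|) := by rw [abs_of_neg hb]; ring
  obtain ⟨f, hf⟩ : ∃ f : squareSummable, numSol a b lam mu u0 n = fun j k => f.1 (j, k) :=
    ⟨⟨_, (mem_squareSummable_iff _).2 hmem⟩, rfl⟩
  have hnext : numSol a b lam mu u0 (n + 1)
      = fun j k => (stepOp (-(lam * |a|)) (-(mu * |b|)) f).1 (j, k) := by
    ext j k
    rw [stepOp_apply, ← ea, ← eb, ← hf]
    rfl
  rw [hnext, hf, energy_eq_form, energy_eq_form, ea, eb, neg_sq, neg_sq]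
  rw [ea, eb, neg_sq, neg_sq] at hsmall
  clear hnext ea eb
  generalize lam * |a| = A at *
  generalize mu * |b| = B at *
  have hr : 0 < 1 / (300 * (1 + M)) := by positivity
  have hrM : 1 / (300 * (1 + M)) * (1 + M) = 1 / 300 := by field_simp
  have main := form_stepOp_le hA hB (sq_add_sq_le_of_comparable hA hB hr hba hrM hsmall)
    (by rw [add_comm] at hsmall ⊢; exact sq_add_sq_le_of_comparable hB hA hr hab hrM hsmall) f
  have sA : ∑' p : ℕ × ℕ, (f.1 (p.1, p.2 + 1) - 2 * f.1 (p.1 + 1, p.2 + 1)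
      + f.1 (p.1 + 2, p.2 + 1)) ^ 2 ≤ form halfWeight halfWeight (diffTwo f) (diffTwo f) := by
    refine le_of_eq_of_le (tsum_congr fun p => ?_) (form_interior_le (diffTwo f))
    rw [diffTwo_succ]
    ring
  have sB : ∑' p : ℕ × ℕ, (f.1 (p.1 + 1, p.2) - 2 * f.1 (p.1 + 1, p.2 + 1)
      + f.1 (p.1 + 1, p.2 + 2)) ^ 2
        ≤ form halfWeight halfWeight (flipEnd diffTwo f) (flipEnd diffTwo f) := by
    refine le_of_eq_of_le (tsum_congr fun p => ?_) (form_interior_le (flipEnd diffTwo f))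
    rw [flip_diffTwo_succ]
    ring
  have tA : ∑' k : ℕ, f.1 (0, k) ^ 2 ≤ 2 * form bdryWeight halfWeight f f := by
    rw [← form_bdry_one]
    linarith [form_flip_half bdryWeight f f, form_flip_bdry_le_one bdryWeight f]
  have tB : ∑' j : ℕ, f.1 (j, 0) ^ 2 ≤ 2 * form halfWeight bdryWeight f f := by
    rw [← form_one_bdry]
    exact form_one_le_half bdryWeight f
  have sA' := mul_le_mul_of_nonneg_left sA (sq_nonneg A)
  have sB' := mul_le_mul_of_nonneg_left sB (sq_nonneg B)
  have tA' := mul_le_mul_of_nonneg_left tA hA.le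
  have tB' := mul_le_mul_of_nonneg_left tB hB.le
  linarith
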